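/- Graphs are finite simple graphs, viewed as structures with equality and one adjacency relation. First-order formulas are taken in negation normal form, and $\mathrm{FO}^k$ denotes those that use only $k$ variables (which may be requantified). The alternation depth of a formula is the maximum length of a sequence of nested alternating quantifiers in it. A sentence distinguishes $G$ from $H$ if it is true on $G$ and false on $H$. If some sentence of $\mathrm{FO}^k$ distinguishes $G$ from $H$, let $A^k(G,H)$ be the minimum alternation depth of such a sentence. For $n\ge 1$ let $A^k(n)$ be the maximum of $A^k(G,H)$ over all pairs of (uncolored) trees $G,H$ with $n$ vertices such that some sentence of $\mathrm{FO}^k$ distinguishes $G$ from $H$ (and $A^k(n)=0$ if there is no such pair). For $i\ge1$ let $\Sigma_i$ (resp. $\Pi_i$) be the set of formulas in which every sequence of nested quantifiers begins with $\exists$ (resp. $\forall$) and has at most $i-1$ quantifier alternations, and let $D^k_{\Sigma_i}(G,H)$ (resp. $D^k_{\Pi_i}(G,H)$) be the minimum quantifier depth of a sentence in $\Sigma_i\cap\mathrm{FO}^k$ (resp. $\Pi_i\cap\mathrm{FO}^k$) that distinguishes $G$ from $H$, and $\infty$ if there is none. Equivalently, this is the minimum number of moves in which Spoiler can win the $k$-pebble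 Ehrenfeucht-Fraïssé game on $G$ and $H$ in which he starts in $G$ (resp. in $H$) and jumps from one graph to the other fewer than $i$ times. Theorem. Let $k\ge3$. Then $$A^k(n)>\log_{k+1}n-2\qquad\text{for every } n\ge1 .$$ Moreover, let $G_0$ and $H_0$ be the path on three vertices, rooted at its middle vertex and at an end vertex, respectively. Let $G_1$ consist of a new root joined to the roots of $k$ copies of $H_0$ and one copy of $G_0$, and let $H_1$ consist of a new root joined to the roots of $k+1$ copies of $H_0$. For $i\ge1$, let $G_{i+1}$ consist of a new root joined to the roots of $k$ copies of $G_i$ and one copy of $H_i$, and let $H_{i+1}$ consist of a new root joined to the roots of $k+1$ copies of $G_i$. Then, for the (unrooted) trees $G_i$ and $H_i$ and every $i\ge1$, $$D^3_{\Sigma_i}(G_i,H_i)\le i+5\qquad\text{and}\qquad D^k_{\Pi_i}(G_i,H_i)=\infty .$$ -/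

import Mathlib

namespace FOAlt

/-- The two first-order quantifiers. -/
inductive Quantifier
  | ex
  | all
  deriving DecidableEq

/-- First-order formulas in negation normal form over the vocabulary of (uncolored) graphs, i.e.
equality and one binary relation symbol for adjacency, all of whose variables, free or bound, are
among `x₀, …, x_{k-1}`. A variable may be quantified again inside the scope of a quantifier that
binds it. -/
inductive Formula (k : ℕ)
  | eq (x y : Fin k)
  | neq (x y : Fin k)
  | adj (x y : Fin k)
  | nadj (x y : Fin k)
  | and (φ ψ : Formula k)
  | or (φ ψ : Formula k)
  | quant (q : Quantifier) (x : Fin k) (φ : Formula k)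

namespace Formula

variable {k : ℕ}

/-- The free variables of a formula. -/
def freeVars : Formula k → Finset (Fin k)
  | eq x y => {x, y}
  | neq x y => {x, y}
  | adj x y => {x, y}
  | nadj x y => {x, y}
  | and φ ψ => φ.freeVars ∪ ψ.freeVars
  | or φ ψ => φ.freeVars ∪ ψ.freeVars
  | quant _ x φ => φ.freeVars.erase x

/-- Truth of a formula in the graph `G` under the assignment `a` of vertices to variables. -/
def Sat {V : Type} (G : SimpleGraph V) : Formula k → (Fin k → V) → Prop
  | eq x y, a => a x = a y
  | neq x y, a => a x ≠ a y
  | adj x y, a => G.Adj (a x) (a y)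
  | nadj x y, a => ¬ G.Adj (a x) (a y)
  | and φ ψ, a => φ.Sat G a ∧ ψ.Sat G a
  | or φ ψ, a => φ.Sat G a ∨ ψ.Sat G a
  | quant .ex x φ, a => ∃ v : V, φ.Sat G (Function.update a x v)
  | quant .all x φ, a => ∀ v : V, φ.Sat G (Function.update a x v)

/-- Quantifier depth. -/
def depth : Formula k → ℕ
  | eq _ _ => 0
  | neq _ _ => 0
  | adj _ _ => 0
  | nadj _ _ => 0
  | and φ ψ => max φ.depth ψ.depth
  | or φ ψ => max φ.depth ψ.depth
  | quant _ _ φ => φ.depth + 1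

/-- The maximal sequences of nested quantifiers of a formula, outermost quantifier first: one for
each occurrence of a literal. -/
def nests : Formula k → List (List Quantifier)
  | eq _ _ => [[]]
  | neq _ _ => [[]]
  | adj _ _ => [[]]
  | nadj _ _ => [[]]
  | and φ ψ => φ.nests ++ ψ.nests
  | or φ ψ => φ.nests ++ ψ.nests
  | quant q _ φ => φ.nests.map (fun s => q :: s)

end Formula

/-- The number of maximal blocks of equal quantifiers in a sequence, that is, the length of a
longest alternating subsequence. A nonempty sequence with `m` quantifier alternations has
`m + 1` blocks. -/
def blocks : List Quantifier → ℕ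
  | [] => 0
  | [_] => 1
  | p :: q :: s => blocks (q :: s) + if p = q then 0 else 1

namespace Formula

variable {k : ℕ}

/-- The alternation depth: the maximum length of a sequence of nested alternating quantifiers. -/
def altDepth (φ : Formula k) : ℕ := (φ.nests.map blocks).foldr max 0

/-- Every sequence of nested quantifiers of `φ` begins with `q` and has at most `i - 1` quantifier
alternations (`1 ≤ i`). -/
def InLevel (q : Quantifier) (i : ℕ) (φ : Formula k) : Prop :=
  ∀ s ∈ φ.nests, (∀ p ∈ s.head?, p = q) ∧ blocks s ≤ i

/-- The class `Σ_i` (meaningful for `1 ≤ i`). -/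
def IsSigma (i : ℕ) (φ : Formula k) : Prop := φ.InLevel .ex i

/-- The class `Π_i` (meaningful for `1 ≤ i`). -/
def IsPi (i : ℕ) (φ : Formula k) : Prop := φ.InLevel .all i

/-- `φ` is a sentence that is true on `G` and false on `H`. -/
def Distinguishes {V W : Type} (φ : Formula k) (G : SimpleGraph V) (H : SimpleGraph W) : Prop :=
  φ.freeVars = ∅ ∧ (∀ a, φ.Sat G a) ∧ ¬ ∀ b, φ.Sat H b

end Formula

/-- `D^k_L(G, H)`: the minimum quantifier depth of a `k`-variable sentence in the class `L` that is
true on `G` and false on `H`; it is `⊤` if there is no such sentence. -/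
noncomputable def distDepth (k : ℕ) (L : Formula k → Prop) {V W : Type}
    (G : SimpleGraph V) (H : SimpleGraph W) : ℕ∞ :=
  ⨅ φ : {φ : Formula k // L φ ∧ φ.Distinguishes G H}, (φ.1.depth : ℕ∞)

/-- Some `k`-variable sentence is true on `G` and false on `H`. -/
def Distinguishable (k : ℕ) {V W : Type} (G : SimpleGraph V) (H : SimpleGraph W) : Prop :=
  ∃ φ : Formula k, φ.Distinguishes G H

/-- `A^k(G, H)`: the minimum alternation depth of a `k`-variable sentence that is true on `G` and
false on `H`. It is used only for `G` and `H` with `Distinguishable k G H`. -/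
noncomputable def altDist (k : ℕ) {V W : Type} (G : SimpleGraph V) (H : SimpleGraph W) : ℕ :=
  sInf {d | ∃ φ : Formula k, φ.Distinguishes G H ∧ φ.altDepth = d}

open Classical in
/-- The alternation function `A^k(n)` over uncolored trees: the maximum of `A^k(G, H)` over the
pairs of `n`-vertex trees distinguishable with `k` variables (`0` if there is no such pair). -/
noncomputable def treeAlt (k n : ℕ) : ℕ :=
  (Finset.univ.filter fun P : SimpleGraph (Fin n) × SimpleGraph (Fin n) =>
    P.1.IsTree ∧ P.2.IsTree ∧ Distinguishable k P.1 P.2).sup fun P => altDist k P.1 P.2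

/-- A graph with a distinguished vertex. -/
structure RootedGraph where
  V : Type
  graph : SimpleGraph V
  root : V

/-- Adjacency in the lifting `RootedGraph.lift`. -/
def liftAdj (m : ℕ) (B C : RootedGraph) :
    Option ((Fin m × B.V) ⊕ C.V) → Option ((Fin m × B.V) ⊕ C.V) → Prop
  | none, none => False
  | none, some (.inl p) => p.2 = B.root
  | none, some (.inr v) => v = C.root
  | some (.inl p), none => p.2 = B.root
  | some (.inr v), none => v = C.root
  | some (.inl p), some (.inl p') => p.1 = p'.1 ∧ B.graph.Adj p.2 p'.2
  | some (.inr v), some (.inr v') => C.graph.Adj v v'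
  | some (.inl _), some (.inr _) => False
  | some (.inr _), some (.inl _) => False

/-- A new root, adjacent to the roots of `m` disjoint copies of `B` and of one copy of `C`. -/
def RootedGraph.lift (m : ℕ) (B C : RootedGraph) : RootedGraph where
  V := Option ((Fin m × B.V) ⊕ C.V)
  graph :=
    { Adj := liftAdj m B C
      symm := ⟨by
        rintro (_ | p | v) (_ | p' | v') h <;>
          simp only [liftAdj] at h ⊢ <;>
          first
            | exact h
            | exact h.symm
            | exact ⟨h.1.symm, h.2.symm⟩⟩
      loopless := ⟨by
        rintro (_ | p | v) h <;> simp [liftAdj] at h⟩ }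
  root := none

/-- The path on three vertices rooted at its middle vertex. -/
def cherry : RootedGraph := ⟨Fin 3, SimpleGraph.pathGraph 3, 1⟩

/-- The path on three vertices rooted at an end vertex. -/
def path3 : RootedGraph := ⟨Fin 3, SimpleGraph.pathGraph 3, 0⟩

/-- The pairs `(G_i, H_i)` of rooted trees obtained from `(cherry, path3)` by lifting with `k + 1`
branches in every level. -/
def treePair (k : ℕ) : ℕ → RootedGraph × RootedGraph
  | 0 => (cherry, path3)
  | 1 => (path3.lift k cherry, path3.lift k path3)
  | i + 2 =>
    let P := treePair k (i + 1)
    (P.1.lift k P.2, P.1.lift k P.1)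

end FOAlt

namespace FOAlt

/-! Duplicator's side. After exchanging the two base trees, every level has the form (k copies of
`B` and one `A`, k + 1 copies of `B`). As long as Spoiler plays in the second tree, Duplicator never
needs the branch `A`: before each move fewer than k pebbles are kept, so one of the k copies of `B`
is free and can be matched with a newly entered branch. When Spoiler jumps, all pebbles lie on
isomorphic parts, and only `A` against a fresh `B` remains, with Spoiler in `A` and one jump spent.
This is the position one level down with the roles exchanged, so i levels absorb every play with
fewer than i jumps (`survives_permuted`, `survives_liftPair`). By `Survives.transfer`, no formula of
level Π_i, and none of alternation depth below i, then distinguishes the trees.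

Spoiler's side. He descends from the root, each time into a child of the opposite type, and
alternates once per level; the base trees differ in the number of children
(`Hangs.hasType_liftPair`). Three variables suffice because only a vertex, its parent and the next
child matter. The root is found without extra alternation: it is the only vertex from which
sufficiently long non-backtracking walks leave in two directions, since ranks bound walks going down
(`IsRank.lt_of_isCentral`).

The logarithmic bound. Level i has fewer than (k + 1)^(i + 1) vertices. Attaching the tree and some
leaves to a new root gives every larger size; Duplicator's strategy survives the padding, and a
three-variable sentence still distinguishes the trees. -/

/-! ### Transfer of formulas along Duplicator strategies -/

/-- The pairs in `S` form a partial isomorphism that respects the roots. -/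
def IsPartialIso (B C : RootedGraph) (S : Set (B.V × C.V)) : Prop :=
  (∀ p ∈ S, (p.1 = B.root ↔ p.2 = C.root)) ∧
    ∀ p ∈ S, ∀ q ∈ S, (p.1 = q.1 ↔ p.2 = q.2) ∧ (B.graph.Adj p.1 q.1 ↔ C.graph.Adj p.2 q.2)

/-- Duplicator survives `m` rounds of the `k`-pebble game from the position `S`, if Spoiler plays in
`B` and jumps to the other graph fewer than `i` times. Jumping takes a round of its own. -/
def Survives (k : ℕ) : (m i : ℕ) → (B C : RootedGraph) → Set (B.V × C.V) → Prop
  | 0, _, B, C, S => IsPartialIso B C S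
  | _ + 1, 0, B, C, S => IsPartialIso B C S
  | m + 1, i + 1, B, C, S => IsPartialIso B C S ∧
      (∀ T ⊆ S, T.encard < k → ∀ v, ∃ w, Survives k m (i + 1) B C (insert (v, w) T)) ∧
      Survives k m i C B (Prod.swap ⁻¹' S)

theorem Survives.isPartialIso {k m i : ℕ} {B C : RootedGraph} {S : Set (B.V × C.V)}
    (h : Survives k m i B C S) : IsPartialIso B C S := by
  cases m <;> cases i <;> simp only [Survives] at h
  all_goals first | exact h | exact h.1

/-- Lets Duplicator waste a round in one component while play takes place in another. -/
theorem Survives.of_succ {k m i : ℕ} {B C : RootedGraph} {S : Set (B.V × C.V)}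
    (h : Survives k (m + 1) i B C S) : Survives k m i B C S := by
  induction m generalizing i B C S with
  | zero => exact h.isPartialIso
  | succ m ih =>
    cases i with
    | zero => exact h.isPartialIso
    | succ i =>
      obtain ⟨h₁, h₂, h₃⟩ := h
      refine ⟨h₁, fun T hT hc v => ?_, ih h₃⟩
      obtain ⟨w, hw⟩ := h₂ T hT hc v
      exact ⟨w, ih hw⟩

theorem one_le_blocks_cons (q : Quantifier) (s : List Quantifier) : 1 ≤ blocks (q :: s) := by
  induction s generalizing q with
  | nil => simp [blocks]
  | cons p s ih =>
    have := ih p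
    simp only [blocks]
    omega

theorem blocks_cons_le (q : Quantifier) (s : List Quantifier) : blocks (q :: s) ≤ blocks s + 1 := by
  cases s with
  | nil => simp [blocks]
  | cons p s => simp only [blocks]; split <;> omega

theorem Formula.nests_ne_nil {k : ℕ} (φ : Formula k) : φ.nests ≠ [] := by
  induction φ <;> simp_all [Formula.nests]

/-- Requantifying `x` lifts its pebble, so at most `k - 1` pebbles stay on the board and the
survival condition applies. -/
theorem Survives.forth {k m i : ℕ} {B C : RootedGraph} {S : Set (B.V × C.V)}
    (h : Survives k (m + 1) (i + 1) B C S) {x : Fin k} {F : Finset (Fin k)}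
    {a : Fin k → B.V} {b : Fin k → C.V} (hS : ∀ y ∈ F.erase x, (a y, b y) ∈ S) (v : B.V) :
    ∃ w S', Survives k m (i + 1) B C S' ∧
      ∀ y ∈ F, (Function.update a x v y, Function.update b x w y) ∈ S' := by
  classical
  have hcard : ((fun y => (a y, b y)) '' (F.erase x : Set (Fin k))).encard < k := by
    refine (Set.encard_image_le _ _).trans_lt ?_
    have h₁ : (F.erase x).card < k := by
      have h₂ := Finset.card_lt_univ_of_notMem (Finset.notMem_erase x F)
      simpa using h₂
    rw [Set.encard_coe_eq_coe_finsetCard]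
    exact_mod_cast h₁
  obtain ⟨w, hw⟩ := h.2.1 _ (by rintro _ ⟨y, hy, rfl⟩; exact hS y hy) hcard v
  refine ⟨w, _, hw, fun y hy => ?_⟩
  by_cases hyx : y = x
  · subst hyx; simp
  · right
    exact ⟨y, Finset.mem_erase.2 ⟨hyx, hy⟩, by simp [hyx]⟩

/-- The quantifier prefixed to `s` records the side on which Spoiler is: `ex` for `B` when truth
passes from `B` to `C`, `all` when it passes back. A new block in the prefixed sequence is then
exactly a jump. -/
theorem Survives.transfer {k : ℕ} (φ : Formula k) {m i : ℕ} {B C : RootedGraph}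
    {S : Set (B.V × C.V)} {a : Fin k → B.V} {b : Fin k → C.V} (h : Survives k m i B C S)
    (hm : 2 * φ.depth ≤ m) (hS : ∀ x ∈ φ.freeVars, (a x, b x) ∈ S) :
    ((∀ s ∈ φ.nests, blocks (.ex :: s) ≤ i) → φ.Sat B.graph a → φ.Sat C.graph b) ∧
      ((∀ s ∈ φ.nests, blocks (.all :: s) ≤ i) → φ.Sat C.graph b → φ.Sat B.graph a) := by
  induction φ generalizing m i B C S a b with
  | eq x y | neq x y | adj x y | nadj x y =>
    have := h.isPartialIso.2 _ (hS x (by simp [Formula.freeVars])) _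
      (hS y (by simp [Formula.freeVars]))
    simp only [Formula.Sat]
    tauto
  | and φ ψ ihφ ihψ | or φ ψ ihφ ihψ =>
    simp only [Formula.depth, Formula.freeVars, Formula.nests, Formula.Sat, Finset.mem_union,
      List.mem_append] at *
    have h₁ := ihφ h (by omega) fun x hx => hS x (.inl hx)
    have h₂ := ihψ h (by omega) fun x hx => hS x (.inr hx)
    constructor
    · intro hb
      have h₃ := h₁.1 fun s hs => hb s (.inl hs)
      have h₄ := h₂.1 fun s hs => hb s (.inr hs)
      tauto
    · intro hb
      have h₃ := h₁.2 fun s hs => hb s (.inl hs)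
      have h₄ := h₂.2 fun s hs => hb s (.inr hs)
      tauto
  | quant q x φ ih =>
    simp only [Formula.depth, Formula.freeVars, Formula.nests, List.forall_mem_map] at *
    -- A quantifier costs one round for the move and possibly one for a jump before it, whence the
    -- factor 2.
    obtain ⟨m, rfl⟩ : ∃ m', m = m' + 2 := ⟨m - 2, by omega⟩
    obtain ⟨s₀, hs₀⟩ := List.exists_mem_of_ne_nil _ φ.nests_ne_nil
    have hS' : ∀ y ∈ φ.freeVars.erase x, (b y, a y) ∈ Prod.swap ⁻¹' S := fun y hy => hS y hy
    have hb₀ := fun q => one_le_blocks_cons q s₀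
    constructor <;> intro hb hsat
    · cases q with
      | ex =>
        simp only [blocks, if_pos, add_zero] at hb
        obtain ⟨i, rfl⟩ : ∃ i', i = i' + 1 := ⟨i - 1, by have := hb s₀ hs₀; have := hb₀ .ex; omega⟩
        obtain ⟨v, hv⟩ := hsat
        obtain ⟨w, S', h', hF⟩ := h.forth hS v
        exact ⟨w, (ih h' (by omega) hF).1 hb hv⟩
      | all =>
        have hb' : ∀ s ∈ φ.nests, blocks (.all :: s) + 1 ≤ i := fun s hs => by
          simpa [blocks] using hb s hs
        obtain ⟨i, rfl⟩ : ∃ i', i = i' + 2 :=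
          ⟨i - 2, by have := hb' s₀ hs₀; have := hb₀ .all; omega⟩
        intro w
        obtain ⟨v, S', h', hF⟩ := Survives.forth h.2.2 hS' w
        exact (ih h' (by omega) hF).2 (fun s hs => by have := hb' s hs; omega) (hsat v)
    · cases q with
      | all =>
        simp only [blocks, if_pos, add_zero] at hb
        obtain ⟨i, rfl⟩ : ∃ i', i = i' + 1 := ⟨i - 1, by have := hb s₀ hs₀; have := hb₀ .all; omega⟩
        intro v
        obtain ⟨w, S', h', hF⟩ := h.forth hS v
        exact (ih h' (by omega) hF).2 hb (hsat w)
      | ex =>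
        have hb' : ∀ s ∈ φ.nests, blocks (.ex :: s) + 1 ≤ i := fun s hs => by
          simpa [blocks] using hb s hs
        obtain ⟨i, rfl⟩ : ∃ i', i = i' + 2 :=
          ⟨i - 2, by have := hb' s₀ hs₀; have := hb₀ .ex; omega⟩
        obtain ⟨w, hw⟩ := hsat
        obtain ⟨v, S', h', hF⟩ := Survives.forth h.2.2 hS' w
        exact ⟨v, (ih h' (by omega) hF).1 (fun s hs => by have := hb' s hs; omega) hw⟩

/-- If Duplicator survives when Spoiler starts in `H`, then no formula of level `Π_i` distinguishes
`G` from `H`. -/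
theorem not_distinguishes_of_survives {k i : ℕ} {G H : RootedGraph}
    (h : ∀ m, Survives k m i H G ∅) (φ : Formula k)
    (hφ : ∀ s ∈ φ.nests, blocks (.all :: s) ≤ i) : ¬ φ.Distinguishes G.graph H.graph := by
  rintro ⟨hfree, hG, hH⟩
  refine hH fun b => ?_
  exact ((h (2 * φ.depth)).transfer φ (a := b) (b := fun _ => G.root) le_rfl
    (by simp [hfree])).2 hφ (hG _)

/-! ### Duplicator strategies on lifted graphs -/

/-- `X` and `X'` arise from a common part `Y` by attaching `A`, respectively `C`, in the same way
along the root. -/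
structure Glue (X X' A C : RootedGraph) (Y : Type) (g : Y → X.V) (g' : Y → X'.V)
    (f : A.V → X.V) (f' : C.V → X'.V) (Q : Y → Prop) : Prop where
  cover : ∀ x, (∃ y, g y = x) ∨ ∃ a, f a = x
  cover' : ∀ x, (∃ y, g' y = x) ∨ ∃ a, f' a = x
  g_inj : Function.Injective g
  g'_inj : Function.Injective g'
  f_inj : Function.Injective f
  f'_inj : Function.Injective f'
  ne : ∀ y a, g y ≠ f a
  ne' : ∀ y a, g' y ≠ f' a
  root : ∀ y, g y = X.root ↔ g' y = X'.root
  f_root : ∀ a, f a ≠ X.root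
  f'_root : ∀ a, f' a ≠ X'.root
  adj : ∀ y z, X.graph.Adj (g y) (g z) ↔ X'.graph.Adj (g' y) (g' z)
  f_adj : ∀ a b, X.graph.Adj (f a) (f b) ↔ A.graph.Adj a b
  f'_adj : ∀ a b, X'.graph.Adj (f' a) (f' b) ↔ C.graph.Adj a b
  cross : ∀ y a, X.graph.Adj (g y) (f a) ↔ Q y ∧ a = A.root
  cross' : ∀ y a, X'.graph.Adj (g' y) (f' a) ↔ Q y ∧ a = C.root

namespace Glue

variable {X X' A C : RootedGraph} {Y : Type} {g : Y → X.V} {g' : Y → X'.V}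
  {f : A.V → X.V} {f' : C.V → X'.V} {Q : Y → Prop}

theorem symm (h : Glue X X' A C Y g g' f f' Q) : Glue X' X C A Y g' g f' f Q where
  cover := h.cover'
  cover' := h.cover
  g_inj := h.g'_inj
  g'_inj := h.g_inj
  f_inj := h.f'_inj
  f'_inj := h.f_inj
  ne := h.ne'
  ne' := h.ne
  root y := (h.root y).symm
  f_root := h.f'_root
  f'_root := h.f_root
  adj y z := (h.adj y z).symm
  f_adj := h.f'_adj
  f'_adj := h.f_adj
  cross := h.cross'
  cross' := h.cross

/-- Edges between the common and the attached part end at the root of the latter. This is why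
partial isomorphisms are required to respect roots. -/
theorem isPartialIso (h : Glue X X' A C Y g g' f f' Q) {R : Set (A.V × C.V)}
    {S : Set (X.V × X'.V)} (hR : IsPartialIso A C R)
    (hS : ∀ p ∈ S, (∃ y, p = (g y, g' y)) ∨ ∃ r ∈ R, p = (f r.1, f' r.2)) :
    IsPartialIso X X' S := by
  refine ⟨fun p hp => ?_, fun p hp q hq => ?_⟩
  · obtain ⟨y, rfl⟩ | ⟨r, hr, rfl⟩ := hS p hp
    · exact h.root y
    · simp [h.f_root, h.f'_root]
  · obtain ⟨y, rfl⟩ | ⟨r, hr, rfl⟩ := hS p hp <;> obtain ⟨z, rfl⟩ | ⟨t, ht, rfl⟩ := hS q hq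
    · exact ⟨by rw [h.g_inj.eq_iff, h.g'_inj.eq_iff], h.adj y z⟩
    · refine ⟨by simp [h.ne, h.ne'], ?_⟩
      simp only [h.cross, h.cross', hR.1 t ht]
    · refine ⟨by simp [(h.ne _ _).symm, (h.ne' _ _).symm], ?_⟩
      simp only [X.graph.adj_comm (f _), X'.graph.adj_comm (f' _), h.cross, h.cross', hR.1 r hr]
    · simpa only [h.f_inj.eq_iff, h.f'_inj.eq_iff, h.f_adj, h.f'_adj] using hR.2 r hr t ht

/-- Duplicator copies moves in the common part and follows the strategy for `A` and `C` in the
attached part; both survive jumps. -/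
theorem survives {k m i : ℕ} (h : Glue X X' A C Y g g' f f' Q) {R : Set (A.V × C.V)}
    {S : Set (X.V × X'.V)} (hR : Survives k m i A C R)
    (hS : ∀ p ∈ S, (∃ y, p = (g y, g' y)) ∨ ∃ r ∈ R, p = (f r.1, f' r.2)) :
    Survives k m i X X' S := by
  induction m generalizing i X X' A C R S with
  | zero => exact h.isPartialIso hR hS
  | succ m ih =>
    cases i with
    | zero => exact h.isPartialIso hR.isPartialIso hS
    | succ i =>
      refine ⟨h.isPartialIso hR.isPartialIso hS, fun T hT hc v => ?_, ?_⟩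
      · obtain ⟨y, rfl⟩ | ⟨a, rfl⟩ := h.cover v
        -- A move in the common part leaves the game on `A` and `C` idle for one round.
        · refine ⟨g' y, ih h hR.of_succ fun p hp => ?_⟩
          obtain rfl | hp := hp
          · exact .inl ⟨y, rfl⟩
          · exact hS p (hT hp)
        · have hinj : Function.Injective fun r : A.V × C.V => (f r.1, f' r.2) :=
            fun r t hrt => Prod.ext (h.f_inj (congrArg Prod.fst hrt))
              (h.f'_inj (congrArg Prod.snd hrt))
          set R' := (fun r : A.V × C.V => (f r.1, f' r.2)) ⁻¹' T with hR'
          have hR'R : R' ⊆ R := by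
            intro r hr
            obtain ⟨y, hy⟩ | ⟨t, ht, hrt⟩ := hS _ (hT hr)
            · exact absurd (congrArg Prod.fst hy).symm (h.ne y r.1)
            · rwa [hinj hrt]
          have hcard : R'.encard < k := by
            rw [← hinj.encard_image]
            exact (Set.encard_le_encard (Set.image_preimage_subset _ _)).trans_lt hc
          obtain ⟨c, hc'⟩ := hR.2.1 R' hR'R hcard a
          refine ⟨f' c, ih h hc' fun p hp => ?_⟩
          obtain rfl | hp := hp
          · exact .inr ⟨(a, c), .inl rfl, rfl⟩
          · obtain hy | ⟨t, ht, rfl⟩ := hS p (hT hp)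
            · exact .inl hy
            · exact .inr ⟨t, .inr hp, rfl⟩
      · refine ih h.symm hR.2.2 fun p hp => ?_
        obtain ⟨y, hy⟩ | ⟨r, hr, hy⟩ := hS _ hp
        · exact .inl ⟨y, by rw [← Prod.swap_swap p, hy, Prod.swap_prod_mk]⟩
        · exact .inr ⟨r.swap, by simpa using hr, by
            rw [← Prod.swap_swap p, hy, Prod.swap_prod_mk]; rfl⟩

end Glue

/-! ### Coordinates and gluings for lifted graphs -/

namespace RootedGraph

variable {m : ℕ} {B C : RootedGraph}

/-- The vertex `v` of the `j`-th copy of `B` in `B.lift m C`. -/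
def copy (m : ℕ) (B C : RootedGraph) (j : Fin m) (v : B.V) : (B.lift m C).V := some (.inl (j, v))

/-- The vertex `v` of the copy of `C` in `B.lift m C`. -/
def last (m : ℕ) (B C : RootedGraph) (v : C.V) : (B.lift m C).V := some (.inr v)

theorem lift_cases {P : (B.lift m C).V → Prop} (root : P (B.lift m C).root)
    (copy : ∀ j v, P (copy m B C j v)) (last : ∀ v, P (last m B C v)) : ∀ v, P v
  | none => root
  | some (.inl (j, v)) => copy j v
  | some (.inr v) => last v

@[simp] theorem copy_inj {i j : Fin m} {v w : B.V} :
    copy m B C i v = copy m B C j w ↔ i = j ∧ v = w :=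
  (Option.some_inj.trans Sum.inl_injective.eq_iff).trans Prod.mk_inj

@[simp] theorem last_inj {v w : C.V} : last m B C v = last m B C w ↔ v = w :=
  Option.some_inj.trans Sum.inr_injective.eq_iff

@[simp] theorem copy_ne_last {j : Fin m} {v : B.V} {w : C.V} :
    copy m B C j v ≠ last m B C w :=
  fun h => Sum.inl_ne_inr (Option.some_inj.1 h)

@[simp] theorem last_ne_copy {j : Fin m} {v : B.V} {w : C.V} :
    last m B C w ≠ copy m B C j v := copy_ne_last.symm

@[simp] theorem copy_ne_root {j : Fin m} {v : B.V} : copy m B C j v ≠ (B.lift m C).root :=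
  Option.some_ne_none _

@[simp] theorem last_ne_root {v : C.V} : last m B C v ≠ (B.lift m C).root :=
  Option.some_ne_none _

@[simp] theorem root_ne_copy {j : Fin m} {v : B.V} : (B.lift m C).root ≠ copy m B C j v :=
  copy_ne_root.symm

@[simp] theorem root_ne_last {v : C.V} : (B.lift m C).root ≠ last m B C v := last_ne_root.symm

@[simp] theorem adj_root_copy {j : Fin m} {v : B.V} :
    (B.lift m C).graph.Adj (B.lift m C).root (copy m B C j v) ↔ v = B.root := Iff.rfl

@[simp] theorem adj_copy_root {j : Fin m} {v : B.V} :
    (B.lift m C).graph.Adj (copy m B C j v) (B.lift m C).root ↔ v = B.root := Iff.rfl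

@[simp] theorem adj_root_last {v : C.V} :
    (B.lift m C).graph.Adj (B.lift m C).root (last m B C v) ↔ v = C.root := Iff.rfl

@[simp] theorem adj_last_root {v : C.V} :
    (B.lift m C).graph.Adj (last m B C v) (B.lift m C).root ↔ v = C.root := Iff.rfl

@[simp] theorem adj_copy_copy {i j : Fin m} {v w : B.V} :
    (B.lift m C).graph.Adj (copy m B C i v) (copy m B C j w) ↔ i = j ∧ B.graph.Adj v w := Iff.rfl

@[simp] theorem adj_last_last {v w : C.V} :
    (B.lift m C).graph.Adj (last m B C v) (last m B C w) ↔ C.graph.Adj v w := Iff.rfl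

@[simp] theorem not_adj_copy_last {j : Fin m} {v : B.V} {w : C.V} :
    ¬ (B.lift m C).graph.Adj (copy m B C j v) (last m B C w) := id

@[simp] theorem not_adj_last_copy {j : Fin m} {v : B.V} {w : C.V} :
    ¬ (B.lift m C).graph.Adj (last m B C w) (copy m B C j v) := id

/-- The part of `B.lift m C` that does not depend on `C`. -/
def common (m : ℕ) (B C : RootedGraph) : Option (Fin m × B.V) → (B.lift m C).V
  | none => (B.lift m C).root
  | some p => copy m B C p.1 p.2

/-- The `m + 1` branches of `B.lift m B`. -/
def branch (m : ℕ) (B : RootedGraph) : Option (Fin m) → B.V → (B.lift m B).V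
  | none => last m B B
  | some j => copy m B B j

/-- The root and the branches that `σ` assigns to the indices below `m`. -/
def permuted (σ : Equiv.Perm (Option (Fin m))) : Option (Fin m × B.V) → (B.lift m B).V
  | none => (B.lift m B).root
  | some p => branch m B (σ (some p.1)) p.2

@[simp] theorem branch_inj {i j : Option (Fin m)} {v w : B.V} :
    branch m B i v = branch m B j w ↔ i = j ∧ v = w := by
  cases i <;> cases j <;> simp [branch]

@[simp] theorem branch_ne_root {j : Option (Fin m)} {v : B.V} :
    branch m B j v ≠ (B.lift m B).root := by
  cases j <;> simp [branch]

@[simp] theorem root_ne_branch {j : Option (Fin m)} {v : B.V} :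
    (B.lift m B).root ≠ branch m B j v := branch_ne_root.symm

@[simp] theorem adj_root_branch {j : Option (Fin m)} {v : B.V} :
    (B.lift m B).graph.Adj (B.lift m B).root (branch m B j v) ↔ v = B.root := by
  cases j <;> simp [branch]

@[simp] theorem adj_branch_root {j : Option (Fin m)} {v : B.V} :
    (B.lift m B).graph.Adj (branch m B j v) (B.lift m B).root ↔ v = B.root := by
  cases j <;> simp [branch]

@[simp] theorem adj_branch_branch {i j : Option (Fin m)} {v w : B.V} :
    (B.lift m B).graph.Adj (branch m B i v) (branch m B j w) ↔ i = j ∧ B.graph.Adj v w := by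
  cases i <;> cases j <;> simp [branch]

theorem branch_cases {P : (B.lift m B).V → Prop} (root : P (B.lift m B).root)
    (branch : ∀ j v, P (branch m B j v)) (v : (B.lift m B).V) : P v :=
  lift_cases root (fun j => branch (some j)) (branch none) v

theorem glue_lift (m : ℕ) (B A C : RootedGraph) :
    Glue (B.lift m A) (B.lift m C) A C (Option (Fin m × B.V)) (common m B A) (common m B C)
      (last m B A) (last m B C) (· = none) where
  cover := lift_cases (.inl ⟨none, rfl⟩) (fun j v => .inl ⟨some (j, v), rfl⟩) fun v => .inr ⟨v, rfl⟩
  cover' := lift_cases (.inl ⟨none, rfl⟩) (fun j v => .inl ⟨some (j, v), rfl⟩) fun v => .inr ⟨v, rfl⟩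
  g_inj := by rintro (_ | p) (_ | q) <;> simp [common, Prod.ext_iff]
  g'_inj := by rintro (_ | p) (_ | q) <;> simp [common, Prod.ext_iff]
  f_inj := by intro v w; simp
  f'_inj := by intro v w; simp
  ne := by rintro (_ | p) a <;> simp [common]
  ne' := by rintro (_ | p) a <;> simp [common]
  root := by rintro (_ | p) <;> simp [common]
  f_root := by simp
  f'_root := by simp
  adj := by rintro (_ | p) (_ | q) <;> simp [common]
  f_adj := by simp
  f'_adj := by simp
  cross := by rintro (_ | p) a <;> simp [common]
  cross' := by rintro (_ | p) a <;> simp [common]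

theorem glue_permuted (m : ℕ) (B A : RootedGraph) (σ : Equiv.Perm (Option (Fin m))) :
    Glue (B.lift m A) (B.lift m B) A B (Option (Fin m × B.V)) (common m B A) (permuted σ)
      (last m B A) (branch m B (σ none)) (· = none) where
  cover := (glue_lift m B A A).cover
  cover' := by
    refine branch_cases (.inl ⟨none, rfl⟩) fun j v => ?_
    obtain ⟨_ | j, rfl⟩ := σ.surjective j
    · exact .inr ⟨v, rfl⟩
    · exact .inl ⟨some (j, v), rfl⟩
  g_inj := (glue_lift m B A A).g_inj
  g'_inj := by rintro (_ | p) (_ | q) <;> simp [permuted, Prod.ext_iff]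
  f_inj := (glue_lift m B A A).f_inj
  f'_inj := by intro v w; simp
  ne := (glue_lift m B A A).ne
  ne' := by rintro (_ | p) a <;> simp [permuted]
  root := by rintro (_ | p) <;> simp [common, permuted]
  f_root := by simp
  f'_root := by simp
  adj := by rintro (_ | p) (_ | q) <;> simp [common, permuted]
  f_adj := by simp
  f'_adj := by simp
  cross := (glue_lift m B A A).cross
  cross' := by rintro (_ | p) a <;> simp [permuted]

theorem survives_lift {k n i : ℕ} (m : ℕ) (B : RootedGraph) {A C : RootedGraph}
    (h : Survives k n i A C ∅) : Survives k n i (B.lift m A) (B.lift m C) ∅ :=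
  (glue_lift m B A C).survives h (by simp)

/-- Here `σ` records which branch of `B.lift k B` is matched with which copy of `B`; the branch `σ
none` is still unmatched. It may change between moves as long as pebbled branches keep their
partners. -/
theorem survives_permuted {k n i : ℕ} {A : RootedGraph} (h : ∀ n, Survives k n i A B ∅)
    (σ : Equiv.Perm (Option (Fin k))) {S : Set ((B.lift k B).V × (B.lift k A).V)}
    (hS : ∀ p ∈ S, ∃ y, p = (permuted σ y, common k B A y)) :
    Survives k n (i + 1) (B.lift k B) (B.lift k A) S := by
  classical
  have hiso (σ : Equiv.Perm (Option (Fin k))) {S : Set ((B.lift k B).V × (B.lift k A).V)}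
      (hS : ∀ p ∈ S, ∃ y, p = (permuted σ y, common k B A y)) :
      IsPartialIso (B.lift k B) (B.lift k A) S :=
    (glue_permuted k B A σ).symm.isPartialIso (R := ∅) (by simp [IsPartialIso])
      fun p hp => .inl (hS p hp)
  induction n generalizing σ S with
  | zero => exact hiso σ hS
  | succ n ih =>
    refine ⟨hiso σ hS, fun T hT hc v => ?_, ?_⟩
    · have key (y) : ∃ w, Survives k n (i + 1) (B.lift k B) (B.lift k A)
          (insert (permuted σ y, w) T) := by
        refine ⟨common k B A y, ih σ fun p hp => ?_⟩
        obtain rfl | hp := hp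
        · exact ⟨y, rfl⟩
        · exact hS p (hT hp)
      obtain ⟨y, rfl⟩ | ⟨v, rfl⟩ := (glue_permuted k B A σ).cover' v
      · exact key y
      -- Spoiler enters the unmatched branch. If each of the k copies carried a pebble, `T` would
      -- contain k distinct pairs.
      · obtain ⟨j, hj⟩ : ∃ j : Fin k, ∀ p ∈ T, ∀ u, p.2 ≠ copy k B A j u := by
          by_contra! hcon
          choose p hpT u hu using hcon
          have hinj : Function.Injective p := fun i j hij => by
            have := hu i
            rw [hij, hu j] at this
            exact (copy_inj.1 this).1.symm
          have h₁ := (Set.encard_le_encard (Set.range_subset_iff.2 hpT)).trans_lt hc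
          rw [← Set.image_univ, hinj.encard_image, Set.encard_univ] at h₁
          simp at h₁
        -- Composing with the transposition gives the free copy `j` to the entered branch and leaves
        -- the former, unpebbled partner of `j` unmatched.
        refine ⟨copy k B A j v, ih ((Equiv.swap (some j) none).trans σ) fun p hp => ?_⟩
        obtain rfl | hp := hp
        · exact ⟨some (j, v), by simp [permuted, common]⟩
        · obtain ⟨_ | ⟨l, u⟩, rfl⟩ := hS p (hT hp)
          · exact ⟨none, rfl⟩
          · have hlj : l ≠ j := by
              rintro rfl
              exact hj _ hp u rfl
            refine ⟨some (l, u), ?_⟩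
            simp [permuted, Equiv.swap_apply_of_ne_of_ne, hlj]
    -- After the jump no pebble lies on `A` or on its counterpart, so the strategy one level down
    -- starts from the empty position.
    · refine (glue_permuted k B A σ).survives (h n) fun p hp => .inl ?_
      obtain ⟨y, hy⟩ := hS _ hp
      exact ⟨y, by rw [← Prod.swap_swap p, hy, Prod.swap_prod_mk]⟩

end RootedGraph

/-- The pairs `(G_i, H_i)`, with `G_0` and `H_0` exchanged, so that every level arises in the same way
from the level below. -/
def liftPair (k : ℕ) : ℕ → RootedGraph × RootedGraph
  | 0 => (path3, cherry)
  | i + 1 => ((liftPair k i).1.lift k (liftPair k i).2, (liftPair k i).1.lift k (liftPair k i).1)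

theorem treePair_succ (k i : ℕ) : treePair k (i + 1) = liftPair k (i + 1) := by
  induction i with
  | zero => rfl
  | succ i ih => rw [treePair, ih]; rfl

theorem survives_liftPair (k n i : ℕ) :
    Survives k n i (liftPair k i).2 (liftPair k i).1 ∅ := by
  induction i generalizing n with
  -- With `i = 0` Spoiler has no move at all, so nothing is asked of the base trees.
  | zero => cases n <;> simp [Survives, IsPartialIso]
  | succ i ih => exact RootedGraph.survives_permuted ih 1 fun p hp => hp.elim

/-! ### Formulas for Spoiler -/

/-- The dual quantifier. -/
def Quantifier.dual : Quantifier → Quantifier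
  | ex => all
  | all => ex

/-! ### Negation, isomorphism invariance and quantifier blocks -/

namespace Formula

variable {k : ℕ}

/-- The negation of a formula, in negation normal form. -/
def neg : Formula k → Formula k
  | eq x y => neq x y
  | neq x y => eq x y
  | adj x y => nadj x y
  | nadj x y => adj x y
  | and φ ψ => or φ.neg ψ.neg
  | or φ ψ => and φ.neg ψ.neg
  | quant q x φ => quant q.dual x φ.neg

@[simp] theorem sat_neg {V : Type} (G : SimpleGraph V) (φ : Formula k) (a : Fin k → V) :
    φ.neg.Sat G a ↔ ¬ φ.Sat G a := by
  induction φ generalizing a with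
  | eq | neq | adj | nadj => simp [neg, Sat]
  | and φ ψ ihφ ihψ => simp only [neg, Sat, ihφ, ihψ]; tauto
  | or φ ψ ihφ ihψ => simp only [neg, Sat, ihφ, ihψ]; tauto
  | quant q x φ ih => cases q <;> simp [neg, Sat, Quantifier.dual, ih]

@[simp] theorem depth_neg (φ : Formula k) : φ.neg.depth = φ.depth := by
  induction φ <;> simp_all [neg, depth]

@[simp] theorem freeVars_neg (φ : Formula k) : φ.neg.freeVars = φ.freeVars := by
  induction φ <;> simp_all [neg, freeVars]

theorem sat_iso {V W : Type} {G : SimpleGraph V} {H : SimpleGraph W} (e : G ≃g H) (φ : Formula k)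
    (a : Fin k → V) : φ.Sat H (e ∘ a) ↔ φ.Sat G a := by
  induction φ generalizing a with
  | eq | neq => simp [Sat]
  | adj | nadj => simp [Sat, e.map_adj_iff]
  | and φ ψ ihφ ihψ | or φ ψ ihφ ihψ => simp only [Sat, ihφ, ihψ]
  | quant q x φ ih =>
    have h (v : V) : φ.Sat H (Function.update (e ∘ a) x (e v)) ↔
        φ.Sat G (Function.update a x v) := by
      rw [← ih, Function.comp_update]
    cases q
    · simp only [Sat, ← h, e.surjective.exists]
    · simp only [Sat, ← h, e.surjective.forall]

theorem forall_sat_iso {V W : Type} {G : SimpleGraph V} {H : SimpleGraph W} (e : G ≃g H)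
    (φ : Formula k) : (∀ b, φ.Sat H b) ↔ ∀ a, φ.Sat G a := by
  refine ⟨fun h a => (sat_iso e φ a).1 (h _), fun h b => ?_⟩
  have := (sat_iso e φ (e.symm ∘ b)).2 (h _)
  simpa [Function.comp_def] using this

theorem distinguishes_iso {V V' W W' : Type} {G : SimpleGraph V} {G' : SimpleGraph V'}
    {H : SimpleGraph W} {H' : SimpleGraph W'} (e : G ≃g G') (f : H ≃g H') (φ : Formula k) :
    φ.Distinguishes G' H' ↔ φ.Distinguishes G H := by
  simp only [Distinguishes, forall_sat_iso e, forall_sat_iso f]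

/-- Every sequence of nested quantifiers of `φ`, preceded by `q`, has at most `i` blocks. -/
def BlocksLE (q : Quantifier) (i : ℕ) (φ : Formula k) : Prop :=
  ∀ s ∈ φ.nests, blocks (q :: s) ≤ i

variable {q : Quantifier} {i : ℕ}

theorem blocksLE_literal {φ : Formula k} (h : φ.nests = [[]]) : φ.BlocksLE q (i + 1) := by
  simp [BlocksLE, h, blocks]

theorem BlocksLE.and {φ ψ : Formula k} (hφ : φ.BlocksLE q i) (hψ : ψ.BlocksLE q i) :
    (φ.and ψ).BlocksLE q i := by
  simp only [BlocksLE, nests, List.mem_append]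
  rintro s (hs | hs)
  exacts [hφ s hs, hψ s hs]

theorem blocksLE_quant {φ : Formula k} {x : Fin k} :
    (quant q x φ).BlocksLE q i ↔ φ.BlocksLE q i := by
  simp [BlocksLE, nests, blocks]

theorem BlocksLE.succ {φ : Formula k} {x : Fin k} {p : Quantifier}
    (h : (quant q x φ).BlocksLE q i) : (quant q x φ).BlocksLE p (i + 1) := by
  simp only [BlocksLE, nests, List.forall_mem_map] at *
  intro s hs
  have h₁ := h s hs
  have h₂ := blocks_cons_le p (q :: s)
  simp only [blocks, if_pos, add_zero] at h₁
  omega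

theorem isSigma_quant {φ : Formula k} {x : Fin k} (h : φ.BlocksLE .ex i) :
    (quant .ex x φ).IsSigma i := by
  simpa [IsSigma, InLevel, nests, BlocksLE] using h

theorem BlocksLE.of_isPi {φ : Formula k} (h : φ.IsPi (i + 1)) : φ.BlocksLE .all (i + 1) := by
  intro s hs
  obtain ⟨h₁, h₂⟩ := h s hs
  cases s with
  | nil => simp [blocks]
  | cons p s =>
    obtain rfl : p = .all := h₁ p rfl
    simpa [blocks] using h₂

/-- Prefixing either quantifier adds at most one block, so small alternation depth is covered by the
game whichever quantifier comes first. -/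
theorem BlocksLE.of_altDepth {φ : Formula k} (h : φ.altDepth ≤ i) : φ.BlocksLE q (i + 1) := by
  intro s hs
  have h₁ : ∀ l : List ℕ, ∀ n ∈ l, n ≤ l.foldr max 0 := by
    intro l
    induction l with
    | nil => simp
    | cons n l ih => simpa using fun m hm => .inr (ih m hm)
  have h₂ := h₁ _ _ (List.mem_map_of_mem (f := blocks) hs)
  have h₃ := blocks_cons_le q s
  unfold altDepth at h
  omega

theorem dual_inj {p q : Quantifier} : p.dual = q.dual ↔ p = q := by
  cases p <;> cases q <;> simp [Quantifier.dual]

theorem blocks_map_dual (s : List Quantifier) : blocks (s.map Quantifier.dual) = blocks s := by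
  induction s with
  | nil => rfl
  | cons p s ih =>
    cases s with
    | nil => rfl
    | cons q s => simpa [blocks, dual_inj] using ih

theorem nests_neg (φ : Formula k) : φ.neg.nests = φ.nests.map (List.map Quantifier.dual) := by
  induction φ <;> simp_all [neg, nests]

theorem blocksLE_neg {φ : Formula k} : φ.neg.BlocksLE q.dual i ↔ φ.BlocksLE q i := by
  simp only [BlocksLE, nests_neg, List.forall_mem_map, ← List.map_cons, blocks_map_dual]

end Formula

/-- There is a non-backtracking walk of length `j` from `v` that does not begin with a step to
`u`. -/
def HasPath {V : Type} (G : SimpleGraph V) : ℕ → V → V → Prop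
  | 0, _, _ => True
  | j + 1, u, v => ∃ w, w ≠ u ∧ G.Adj v w ∧ HasPath G j v w

/-- Non-backtracking walks of length `j + 1` leave `v` in two directions. -/
def IsCentral {V : Type} (G : SimpleGraph V) (j : ℕ) (v : V) : Prop :=
  ∃ x y, x ≠ y ∧ G.Adj v x ∧ G.Adj v y ∧ HasPath G j v x ∧ HasPath G j v y

/-- In a tree in which `u` is the parent of `v`, this says that `v` has two children or a descendant
three levels below. For `path3` and `cherry` it depends only on the number of children. -/
def HasBranching {V : Type} (G : SimpleGraph V) (u v : V) : Prop :=
  ∃ x, G.Adj v x ∧ x ≠ u ∧ ∃ y, y ≠ u ∧ y ≠ x ∧ ∃ z, G.Adj x z ∧ G.Adj z y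

/-- The property that separates the rooted trees of `liftPair k i`, hanging at `v` below `u`. -/
def HasType {V : Type} (G : SimpleGraph V) : ℕ → V → V → Prop
  | 0, u, v => ¬ HasBranching G u v
  | i + 1, u, v => ∃ w, w ≠ u ∧ G.Adj v w ∧ ¬ HasType G i v w

/-! ### Three-variable formulas and the distinguishing sentences -/

namespace Formula

variable {k : ℕ}

/-- A formula for `HasPath`. -/
def path : ℕ → (u v w : Fin k) → Formula k
  | 0, u, _, _ => eq u u
  | j + 1, u, v, w => quant .ex w (and (neq w u) (and (adj v w) (path j v w u)))

/-- A formula for `IsCentral`. -/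
def central (j : ℕ) (u v w : Fin k) : Formula k :=
  quant .ex u (quant .ex w
    (and (neq u w) (and (adj v u) (and (adj v w) (and (path j v u w) (path j v w u))))))

/-- A formula for `HasBranching`. -/
def branching (u v w : Fin k) : Formula k :=
  quant .ex w (and (adj v w) (and (neq w u) (quant .ex v (and (neq v u) (and (neq v w)
    (quant .ex u (and (adj w u) (adj u v))))))))

/-- A formula for `HasType`. -/
def type : ℕ → (u v w : Fin k) → Formula k
  | 0, u, v, w => (branching u v w).neg
  | i + 1, u, v, w => quant .ex w (and (neq w u) (and (adj v w) (type i v w u).neg))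

section Sat

variable {V : Type} (G : SimpleGraph V) {u v w : Fin k}

theorem sat_path (huv : u ≠ v) (huw : u ≠ w) (hvw : v ≠ w) (j : ℕ) (a : Fin k → V) :
    (path j u v w).Sat G a ↔ HasPath G j (a u) (a v) := by
  induction j generalizing u v w a with
  | zero => simp [path, Sat, HasPath]
  | succ j ih =>
    simp [path, Sat, HasPath, ih hvw huv.symm huw.symm, huw, hvw]

theorem sat_central (huv : u ≠ v) (huw : u ≠ w) (hvw : v ≠ w) (j : ℕ) (a : Fin k → V) :
    (central j u v w).Sat G a ↔ IsCentral G j (a v) := by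
  simp [central, Sat, IsCentral, sat_path G huv.symm hvw huw,
    sat_path G hvw huv.symm huw.symm, huw, huv.symm, hvw]

/-- Two children and their parent, kept apart from `u`, would take four variables. Instead `v` is
overwritten by the second vertex while `u` still denotes the parent, and `u` is overwritten last, by
a common neighbour. -/
theorem sat_branching (huv : u ≠ v) (huw : u ≠ w) (hvw : v ≠ w) (a : Fin k → V) :
    (branching u v w).Sat G a ↔ HasBranching G (a u) (a v) := by
  simp [branching, Sat, HasBranching, huw, huv, hvw, huv.symm, huw.symm, hvw.symm]

theorem sat_type (huv : u ≠ v) (huw : u ≠ w) (hvw : v ≠ w) (i : ℕ) (a : Fin k → V) :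
    (type i u v w).Sat G a ↔ HasType G i (a u) (a v) := by
  induction i generalizing u v w a with
  | zero => simp [type, HasType, sat_branching G huv huw hvw]
  | succ i ih =>
    simp [type, Sat, HasType, ih hvw huv.symm huw.symm, huw, hvw]

end Sat

variable (u v w : Fin k)

theorem freeVars_path (j : ℕ) : (path j u v w).freeVars ⊆ {u, v} := by
  induction j generalizing u v w with
  | zero => simp [path, freeVars]
  | succ j ih =>
    intro x hx
    have := @ih v w u x
    simp only [path, freeVars, Finset.mem_erase, Finset.mem_union, Finset.mem_insert,
      Finset.mem_singleton] at *
    tauto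

theorem freeVars_central (j : ℕ) : (central j u v w).freeVars ⊆ {v} := by
  intro x hx
  have h₁ := @freeVars_path k v u w j x
  have h₂ := @freeVars_path k v w u j x
  simp only [central, freeVars, Finset.mem_erase, Finset.mem_union, Finset.mem_insert,
    Finset.mem_singleton] at *
  tauto

theorem freeVars_branching : (branching u v w).freeVars ⊆ {u, v} := by
  intro x hx
  simp only [branching, freeVars, Finset.mem_erase, Finset.mem_union, Finset.mem_insert,
    Finset.mem_singleton] at *
  tauto

theorem freeVars_type (i : ℕ) : (type i u v w).freeVars ⊆ {u, v} := by
  induction i generalizing u v w with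
  | zero => simpa [type] using freeVars_branching u v w
  | succ i ih =>
    intro x hx
    have := @ih v w u x
    simp only [type, freeVars, freeVars_neg, Finset.mem_erase, Finset.mem_union, Finset.mem_insert,
      Finset.mem_singleton] at *
    tauto

theorem depth_path (j : ℕ) : (path j u v w).depth = j := by
  induction j generalizing u v w with
  | zero => rfl
  | succ j ih => simp [path, depth, ih]

theorem depth_central (j : ℕ) : (central j u v w).depth = j + 2 := by
  simp [central, depth, depth_path]

theorem depth_type (i : ℕ) : (type i u v w).depth = i + 3 := by
  induction i generalizing u v w with
  | zero => simp [type, branching, depth]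
  | succ i ih => simp [type, depth, ih, add_right_comm]

theorem blocksLE_path (i j : ℕ) : (path j u v w).BlocksLE .ex (i + 1) := by
  induction j generalizing u v w with
  | zero => exact blocksLE_literal rfl
  | succ j ih =>
    exact blocksLE_quant.2 (.and (blocksLE_literal rfl) (.and (blocksLE_literal rfl) (ih v w u)))

theorem blocksLE_central (i j : ℕ) : (central j u v w).BlocksLE .ex (i + 1) :=
  blocksLE_quant.2 <| blocksLE_quant.2 <| .and (blocksLE_literal rfl) <|
    .and (blocksLE_literal rfl) <| .and (blocksLE_literal rfl) <|
      .and (blocksLE_path v u w i j) (blocksLE_path v w u i j)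

theorem blocksLE_branching (i : ℕ) : (branching u v w).BlocksLE .ex (i + 1) :=
  blocksLE_quant.2 <| .and (blocksLE_literal rfl) <| .and (blocksLE_literal rfl) <|
    blocksLE_quant.2 <| .and (blocksLE_literal rfl) <| .and (blocksLE_literal rfl) <|
      blocksLE_quant.2 <| .and (blocksLE_literal rfl) (blocksLE_literal rfl)

/-- Type 0 is universal, so its negation inside type 1 is existential and the lowest level costs no
alternation. -/
theorem blocksLE_type (i : ℕ) : (type (i + 1) u v w).BlocksLE .ex (i + 1) := by
  induction i generalizing u v w with
  | zero =>
    exact blocksLE_quant.2 <| .and (blocksLE_literal rfl) <| .and (blocksLE_literal rfl) <|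
      blocksLE_neg (q := .all).2 <| blocksLE_neg (q := .ex).2 <| blocksLE_branching _ _ _ 0
  | succ i ih =>
    exact blocksLE_quant.2 <| .and (blocksLE_literal rfl) <| .and (blocksLE_literal rfl) <|
      blocksLE_neg (q := .all).2 (ih v w u).succ

/-- The sentence for the trees of `liftPair k (i + 1)`. -/
def rootSentence (i : ℕ) : Formula k :=
  quant .ex v (and (central (i + 2) u v w) (quant .ex u (and (eq u v) (type (i + 1) u v w))))

theorem freeVars_rootSentence (i : ℕ) : (rootSentence u v w i).freeVars = ∅ := by
  refine Finset.eq_empty_of_forall_notMem fun x hx => ?_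
  have h₁ := @freeVars_central k u v w (i + 2) x
  have h₂ := @freeVars_type k u v w (i + 1) x
  simp only [rootSentence, freeVars, Finset.mem_erase, Finset.mem_union, Finset.mem_insert,
    Finset.mem_singleton] at *
  tauto

theorem depth_rootSentence (i : ℕ) : (rootSentence u v w i).depth = i + 1 + 5 := by
  simp [rootSentence, depth, depth_central, depth_type]

theorem isSigma_rootSentence (i : ℕ) : (rootSentence u v w i).IsSigma (i + 1) :=
  isSigma_quant <| .and (blocksLE_central _ _ _ _ _) <| blocksLE_quant.2 <|
    .and (blocksLE_literal rfl) (blocksLE_type _ _ _ _)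

theorem sat_rootSentence {u v w : Fin k} (huv : u ≠ v) (huw : u ≠ w) (hvw : v ≠ w) {V : Type}
    (G : SimpleGraph V) (i : ℕ) (a : Fin k → V) : (rootSentence u v w i).Sat G a ↔
      ∃ r, IsCentral G (i + 2) r ∧ HasType G (i + 1) r r := by
  simp [rootSentence, Sat, sat_central G huv huw hvw, sat_type G huv huw hvw, huv.symm]

/-- The sentence for the trees of `liftPair k (i + 1)` below a vertex whose other neighbours are
leaves. -/
def paddedSentence (i : ℕ) : Formula k :=
  quant .ex v (and (central (i + 2) u v w)
    (quant .ex u (and (adj v u) (and (path 2 v u w).neg (type (i + 1) u v w)))))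

theorem freeVars_paddedSentence (i : ℕ) : (paddedSentence u v w i).freeVars = ∅ := by
  refine Finset.eq_empty_of_forall_notMem fun x hx => ?_
  have h₁ := @freeVars_central k u v w (i + 2) x
  have h₂ := @freeVars_type k u v w (i + 1) x
  have h₃ := @freeVars_path k v u w 2 x
  simp only [paddedSentence, freeVars, freeVars_neg, Finset.mem_erase, Finset.mem_union,
    Finset.mem_insert, Finset.mem_singleton] at *
  tauto

theorem sat_paddedSentence {u v w : Fin k} (huv : u ≠ v) (huw : u ≠ w) (hvw : v ≠ w) {V : Type}
    (G : SimpleGraph V) (i : ℕ) (a : Fin k → V) : (paddedSentence u v w i).Sat G a ↔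
      ∃ r, IsCentral G (i + 2) r ∧
        ∃ p, G.Adj r p ∧ ¬ HasPath G 2 r p ∧ HasType G (i + 1) p r := by
  simp [paddedSentence, Sat, sat_central G huv huw hvw, sat_type G huv huw hvw,
    sat_path G huv.symm hvw huw, huv.symm]

end Formula

theorem HasPath.mono {V : Type} {G : SimpleGraph V} {i j : ℕ} (h : i ≤ j) {u v : V}
    (hp : HasPath G j u v) : HasPath G i u v := by
  induction i generalizing j u v with
  | zero => trivial
  | succ i ih =>
    obtain ⟨j, rfl⟩ : ∃ j', j = j' + 1 := ⟨j - 1, by omega⟩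
    obtain ⟨w, h₁, h₂, h₃⟩ := hp
    exact ⟨w, h₁, h₂, ih (by omega) h₃⟩

/-! ### Rank functions on rooted trees -/

/-- `ρ` increases along every path to the root, and a vertex has at most one neighbour that does
not have smaller rank. -/
structure IsRank (B : RootedGraph) (ρ : B.V → ℕ) : Prop where
  lt_root : ∀ v, v ≠ B.root → ρ v < ρ B.root
  up : ∀ v, v ≠ B.root → ∃ u, B.graph.Adj v u ∧ ρ v < ρ u
  unique : ∀ v x y, B.graph.Adj v x → B.graph.Adj v y → ρ v ≤ ρ x → ρ v ≤ ρ y → x = y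

/-- The rank function on `B.lift m C` with value `h` at the root. -/
def liftRank {B C : RootedGraph} (m h : ℕ) (ρ : B.V → ℕ) (τ : C.V → ℕ) : (B.lift m C).V → ℕ
  | none => h
  | some (.inl p) => ρ p.2
  | some (.inr v) => τ v

section liftRank

variable {B C : RootedGraph} {m h : ℕ} {ρ : B.V → ℕ} {τ : C.V → ℕ}

@[simp] theorem liftRank_root : liftRank m h ρ τ (B.lift m C).root = h := rfl

@[simp] theorem liftRank_copy (j : Fin m) (v : B.V) :
    liftRank m h ρ τ (RootedGraph.copy m B C j v) = ρ v := rfl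

@[simp] theorem liftRank_last (v : C.V) :
    liftRank m h ρ τ (RootedGraph.last m B C v) = τ v := rfl

end liftRank

open RootedGraph

namespace IsRank

variable {B C : RootedGraph} {ρ : B.V → ℕ} {τ : C.V → ℕ}

theorem le_root (h : IsRank B ρ) (v : B.V) : ρ v ≤ ρ B.root := by
  by_cases hv : v = B.root
  · rw [hv]
  · exact (h.lt_root v hv).le

theorem lt_root_of_adj (h : IsRank B ρ) {v : B.V} (hv : B.graph.Adj B.root v) :
    ρ v < ρ B.root := h.lt_root v hv.ne'

theorem lift (hB : IsRank B ρ) (hC : IsRank C τ) (m : ℕ) {h : ℕ} (h₁ : ρ B.root < h)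
    (h₂ : τ C.root < h) : IsRank (B.lift m C) (liftRank m h ρ τ) where
  lt_root := lift_cases (by simp) (fun _ v _ => (hB.le_root v).trans_lt h₁)
    fun v _ => (hC.le_root v).trans_lt h₂
  up := by
    refine lift_cases (by simp) (fun j v _ => ?_) fun v _ => ?_
    · by_cases hv : v = B.root
      · exact ⟨(B.lift m C).root, by simpa using hv, by simpa [hv] using h₁⟩
      · obtain ⟨u, hu⟩ := hB.up v hv
        exact ⟨RootedGraph.copy m B C j u, by simpa using hu⟩
    · by_cases hv : v = C.root
      · exact ⟨(B.lift m C).root, by simpa using hv, by simpa [hv] using h₂⟩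
      · obtain ⟨u, hu⟩ := hC.up v hv
        exact ⟨RootedGraph.last m B C u, by simpa using hu⟩
  unique := by
    refine lift_cases ?_ (fun i v => ?_) fun v => ?_
    · have key : ∀ x, (B.lift m C).graph.Adj (B.lift m C).root x → ¬ h ≤ liftRank m h ρ τ x :=
        lift_cases (by simp) (by simpa using fun _ => h₁) (by simpa using h₂)
      intro x y hx _ hx' _
      exact absurd hx' (key x hx)
    · refine lift_cases (lift_cases ?_ ?_ ?_) (fun i x => lift_cases ?_ ?_ ?_)
        fun x => lift_cases ?_ ?_ ?_
      · simp
      · rintro j y hv ⟨rfl, hy⟩ - hle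
        rw [adj_copy_root] at hv
        subst hv
        exact absurd hle (hB.lt_root_of_adj hy).not_ge
      · simp
      · rintro ⟨rfl, hx⟩ hv hle -
        rw [adj_copy_root] at hv
        subst hv
        exact absurd hle (hB.lt_root_of_adj hx).not_ge
      · rintro j y ⟨rfl, hx⟩ ⟨rfl, hy⟩ hle hle'
        rw [hB.unique v x y hx hy hle hle']
      all_goals simp
    · refine lift_cases (lift_cases ?_ ?_ ?_) (fun i x => lift_cases ?_ ?_ ?_)
        fun x => lift_cases ?_ ?_ ?_
      · simp
      · simp
      · rintro y hv hy - hle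
        rw [adj_last_root] at hv
        subst hv
        exact absurd hle (hC.lt_root_of_adj hy).not_ge
      · simp
      · simp
      · simp
      · rintro hx hv hle -
        rw [adj_last_root] at hv
        subst hv
        exact absurd hle (hC.lt_root_of_adj hx).not_ge
      · simp
      · intro y hx hy hle hle'
        rw [hC.unique v x y hx hy hle hle']

/-- A walk that arrives from above cannot turn back, so its rank drops at every step. -/
theorem le_of_hasPath (h : IsRank B ρ) {j : ℕ} {u v : B.V} (huv : B.graph.Adj v u)
    (hlt : ρ v ≤ ρ u) (hp : HasPath B.graph j u v) : j ≤ ρ v := by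
  induction j generalizing u v with
  | zero => exact Nat.zero_le _
  | succ j ih =>
    obtain ⟨w, hwu, hvw, hw⟩ := hp
    have hwv : ρ w < ρ v := by
      by_contra! hle
      exact hwu (h.unique v w u hvw huv hle hlt)
    have := ih hvw.symm hwv.le hw
    omega

/-- At most one of the two directions leads upwards; the walk in the other one loses rank at every
step. -/
theorem lt_of_isCentral (h : IsRank B ρ) {j : ℕ} {v : B.V} (hv : IsCentral B.graph j v) :
    j < ρ v := by
  obtain ⟨x, y, hxy, hx, hy, hpx, hpy⟩ := hv
  by_cases hle : ρ v ≤ ρ x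
  · have hlt : ρ y < ρ v := by
      by_contra! hle'
      exact hxy (h.unique v x y hx hy hle hle')
    exact (h.le_of_hasPath hy.symm hlt.le hpy).trans_lt hlt
  · push Not at hle
    exact (h.le_of_hasPath hx.symm hle.le hpx).trans_lt hle

theorem reachable_root (h : IsRank B ρ) (v : B.V) : B.graph.Reachable v B.root := by
  induction hn : ρ B.root - ρ v using Nat.strong_induction_on generalizing v with
  | _ n ih =>
    by_cases hv : v = B.root
    · rw [hv]
    · obtain ⟨u, hvu, hlt⟩ := h.up v hv
      have := h.le_root u
      exact hvu.reachable.trans (ih _ (by omega) u rfl)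

theorem isAcyclic (h : IsRank B ρ) : B.graph.IsAcyclic := by
  classical
  intro v c hc
  -- A vertex of least rank on a cycle has two distinct neighbours there, neither of smaller rank,
  -- against uniqueness.
  obtain ⟨x, hx, hmin⟩ := c.support.toFinset.exists_min_image ρ ⟨v, by simp⟩
  have hx' := List.mem_toFinset.1 hx
  have hd := hc.rotate hx'
  have hle (y) (hy : y ∈ (c.rotate x hx').support) : ρ x ≤ ρ y :=
    hmin y (List.mem_toFinset.2 ((c.mem_support_rotate_iff x hx').1 hy))
  exact hd.snd_ne_penultimate (h.unique x _ _ (SimpleGraph.Walk.adj_snd hd.not_nil)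
    (SimpleGraph.Walk.adj_penultimate hd.not_nil).symm (hle _ (SimpleGraph.Walk.getVert_mem_support _ _))
    (hle _ (SimpleGraph.Walk.getVert_mem_support _ _)))

theorem isTree (h : IsRank B ρ) : B.graph.IsTree where
  connected :=
    { preconnected := fun v w => (h.reachable_root v).trans (h.reachable_root w).symm
      nonempty := ⟨B.root⟩ }
  isAcyclic := h.isAcyclic

end IsRank

theorem cherry_adj {v w : Fin 3} :
    cherry.graph.Adj v w ↔ v.val + 1 = w.val ∨ w.val + 1 = v.val := SimpleGraph.pathGraph_adj

theorem path3_adj {v w : Fin 3} :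
    path3.graph.Adj v w ↔ v.val + 1 = w.val ∨ w.val + 1 = v.val := SimpleGraph.pathGraph_adj

theorem isRank_cherry : IsRank cherry (![1, 2, 1] : Fin 3 → ℕ) where
  lt_root := show ∀ v : Fin 3, v ≠ 1 → _ by decide
  up := show ∀ v : Fin 3, v ≠ 1 → ∃ u : Fin 3, _ by simp only [cherry_adj]; decide
  unique := by
    suffices ∀ v x y : Fin 3, cherry.graph.Adj v x → cherry.graph.Adj v y →
        (![1, 2, 1] : Fin 3 → ℕ) v ≤ (![1, 2, 1] : Fin 3 → ℕ) x →
        (![1, 2, 1] : Fin 3 → ℕ) v ≤ (![1, 2, 1] : Fin 3 → ℕ) y → x = y from this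
    simp only [cherry_adj]
    decide

theorem isRank_path3 : IsRank path3 (![2, 1, 0] : Fin 3 → ℕ) where
  lt_root := show ∀ v : Fin 3, v ≠ 0 → _ by decide
  up := show ∀ v : Fin 3, v ≠ 0 → ∃ u : Fin 3, _ by simp only [path3_adj]; decide
  unique := by
    suffices ∀ v x y : Fin 3, path3.graph.Adj v x → path3.graph.Adj v y →
        (![2, 1, 0] : Fin 3 → ℕ) v ≤ (![2, 1, 0] : Fin 3 → ℕ) x →
        (![2, 1, 0] : Fin 3 → ℕ) v ≤ (![2, 1, 0] : Fin 3 → ℕ) y → x = y from this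
    simp only [path3_adj]
    decide

theorem exists_isRank_liftPair (k i : ℕ) :
    (∃ ρ, IsRank (liftPair k i).1 ρ ∧ ρ (liftPair k i).1.root = i + 2) ∧
      ∃ ρ, IsRank (liftPair k i).2 ρ ∧ ρ (liftPair k i).2.root = i + 2 := by
  induction i with
  | zero => exact ⟨⟨_, isRank_path3, rfl⟩, ⟨_, isRank_cherry, rfl⟩⟩
  | succ i ih =>
    obtain ⟨⟨ρ, hρ, h₁⟩, ⟨τ, hτ, h₂⟩⟩ := ih
    exact ⟨⟨_, hρ.lift hτ k (h := i + 1 + 2) (by omega) (by omega), rfl⟩,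
      ⟨_, hρ.lift hρ k (h := i + 1 + 2) (by omega) (by omega), rfl⟩⟩

/-! ### Hanging subtrees -/

/-- `f` embeds `B` into `G` in such a way that, apart from edges of `B`, the only edge of `G` at the
image can be one between the image of the root and `p`. The case `p = f B.root` is allowed. -/
structure Hangs (B : RootedGraph) {V : Type} (G : SimpleGraph V) (f : B.V → V) (p : V) : Prop where
  inj : Function.Injective f
  ne : ∀ v, v ≠ B.root → f v ≠ p
  adj : ∀ v w, G.Adj (f v) (f w) ↔ B.graph.Adj v w
  root : ∀ x, G.Adj (f B.root) x → x ≠ p → ∃ w, f w = x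
  other : ∀ v, v ≠ B.root → ∀ x, G.Adj (f v) x → ∃ w, f w = x

theorem hangs_self (B : RootedGraph) : Hangs B B.graph id B.root where
  inj := Function.injective_id
  ne _ hv := hv
  adj _ _ := Iff.rfl
  root x _ _ := ⟨x, rfl⟩
  other _ _ x _ := ⟨x, rfl⟩

namespace Hangs

variable {B C : RootedGraph} {m : ℕ} {V : Type} {G : SimpleGraph V}

theorem copy {f : (B.lift m C).V → V} {p : V} (h : Hangs (B.lift m C) G f p) (j : Fin m) :
    Hangs B G (fun v => f (copy m B C j v)) (f (B.lift m C).root) := by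
  have key (v : B.V) (x : V) (hx : G.Adj (f (RootedGraph.copy m B C j v)) x) :
      x = f (B.lift m C).root ∧ v = B.root ∨ ∃ w, f (RootedGraph.copy m B C j w) = x := by
    obtain ⟨w, rfl⟩ := h.other _ copy_ne_root x hx
    rw [h.adj] at hx
    revert hx
    refine lift_cases (P := fun w => (B.lift m C).graph.Adj (RootedGraph.copy m B C j v) w →
      f w = f (B.lift m C).root ∧ v = B.root ∨ ∃ u, f (RootedGraph.copy m B C j u) = f w)
      ?_ (fun l w => ?_) (fun w => ?_) w
    · intro hv
      exact .inl ⟨rfl, hv⟩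
    · rintro ⟨rfl, -⟩
      exact .inr ⟨w, rfl⟩
    · intro hv
      exact (not_adj_copy_last hv).elim
  exact
    { inj := fun v w hvw => (copy_inj.1 (h.inj hvw)).2
      ne := fun v _ hv => copy_ne_root (h.inj hv)
      adj := fun v w => by rw [h.adj]; simp
      root := fun x hx hne => (key _ x hx).resolve_left fun hx' => hne hx'.1
      other := fun v hv x hx => (key v x hx).resolve_left fun hx' => hv hx'.2 }

theorem last {f : (B.lift m C).V → V} {p : V} (h : Hangs (B.lift m C) G f p) :
    Hangs C G (fun v => f (last m B C v)) (f (B.lift m C).root) := by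
  have key (v : C.V) (x : V) (hx : G.Adj (f (RootedGraph.last m B C v)) x) :
      x = f (B.lift m C).root ∧ v = C.root ∨ ∃ w, f (RootedGraph.last m B C w) = x := by
    obtain ⟨w, rfl⟩ := h.other _ last_ne_root x hx
    rw [h.adj] at hx
    revert hx
    refine lift_cases (P := fun w => (B.lift m C).graph.Adj (RootedGraph.last m B C v) w →
      f w = f (B.lift m C).root ∧ v = C.root ∨ ∃ u, f (RootedGraph.last m B C u) = f w)
      ?_ (fun l w => ?_) (fun w => ?_) w
    · intro hv
      exact .inl ⟨rfl, hv⟩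
    · intro hv
      exact (not_adj_last_copy hv).elim
    · intro _
      exact .inr ⟨w, rfl⟩
  exact
    { inj := fun v w hvw => last_inj.1 (h.inj hvw)
      ne := fun v _ hv => last_ne_root (h.inj hv)
      adj := fun v w => by rw [h.adj]; simp
      root := fun x hx hne => (key _ x hx).resolve_left fun hx' => hne hx'.1
      other := fun v hv x hx => (key v x hx).resolve_left fun hx' => hv hx'.2 }

/-- The neighbours of the root of a lifting, other than `p`, are the roots of its branches. -/
theorem adj_cases {f : (B.lift m C).V → V} {p : V} (h : Hangs (B.lift m C) G f p) {x : V}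
    (hx : G.Adj (f (B.lift m C).root) x) (hne : x ≠ p) :
    (∃ j, x = f (RootedGraph.copy m B C j B.root)) ∨ x = f (RootedGraph.last m B C C.root) := by
  obtain ⟨w, rfl⟩ := h.root x hx hne
  rw [h.adj] at hx
  revert hx
  refine lift_cases (P := fun w => (B.lift m C).graph.Adj (B.lift m C).root w →
    (∃ j, f w = f (RootedGraph.copy m B C j B.root)) ∨ f w = f (RootedGraph.last m B C C.root))
    (by simp) (fun l w => ?_) (fun w => ?_) w
  · rintro rfl
    exact .inl ⟨l, rfl⟩
  · rintro rfl
    exact .inr rfl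

theorem adj_copy {f : (B.lift m C).V → V} {p : V} (h : Hangs (B.lift m C) G f p) (j : Fin m) :
    G.Adj (f (B.lift m C).root) (f (RootedGraph.copy m B C j B.root)) := by
  rw [h.adj]; simp

theorem adj_last {f : (B.lift m C).V → V} {p : V} (h : Hangs (B.lift m C) G f p) :
    G.Adj (f (B.lift m C).root) (f (RootedGraph.last m B C C.root)) := by
  rw [h.adj]; simp

/-- From the only child `x`, two steps lead back to `x`, or to `p`, which is excluded. -/
theorem not_hasBranching_path3 {f : path3.V → V} {p : V} (h : Hangs path3 G f p) :
    ¬ HasBranching G p (f path3.root) := by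
  have h₀ (x : V) (hx : G.Adj (f (0 : Fin 3)) x) (hne : x ≠ p) : x = f (1 : Fin 3) := by
    obtain ⟨w, rfl⟩ := h.root x hx hne
    replace hx := (h.adj _ _).1 hx
    have key : ∀ w : Fin 3, path3.graph.Adj (0 : Fin 3) w → w = 1 := by
      simp only [path3_adj]; decide
    rw [key w hx]
  have h₁ (v : Fin 3) (hv : v ≠ 0) (x : V) (hx : G.Adj (f v) x) :
      ∃ w : Fin 3, path3.graph.Adj v w ∧ f w = x := by
    obtain ⟨w, rfl⟩ := h.other v hv x hx
    exact ⟨w, (h.adj _ _).1 hx, rfl⟩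
  rintro ⟨x, hx, hxp, y, hyp, hyx, z, hxz, hzy⟩
  obtain rfl := h₀ x hx hxp
  obtain ⟨t, ht, rfl⟩ := h₁ 1 (by decide) z hxz
  have key : ∀ t : Fin 3, path3.graph.Adj (1 : Fin 3) t → t = 0 ∨ t = 2 := by
    simp only [path3_adj]; decide
  obtain rfl | rfl := key t ht
  · exact hyx (h₀ y hzy hyp)
  · obtain ⟨s, hs, rfl⟩ := h₁ 2 (by decide) y hzy
    have key : ∀ s : Fin 3, path3.graph.Adj (2 : Fin 3) s → s = 1 := by
      simp only [path3_adj]; decide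
    exact hyx (by rw [key s hs])

theorem hasBranching_cherry {f : cherry.V → V} {p : V} (h : Hangs cherry G f p) :
    HasBranching G p (f cherry.root) := by
  have h₀ : cherry.graph.Adj (0 : Fin 3) (1 : Fin 3) := by rw [cherry_adj]; decide
  have h₂ : cherry.graph.Adj (1 : Fin 3) (2 : Fin 3) := by rw [cherry_adj]; decide
  refine ⟨f (0 : Fin 3), (h.adj _ _).2 h₀.symm, h.ne _ (show (0 : Fin 3) ≠ 1 by decide),
    f (2 : Fin 3), h.ne _ (show (2 : Fin 3) ≠ 1 by decide), fun h' => ?_,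
    f (1 : Fin 3), (h.adj _ _).2 h₀, (h.adj _ _).2 h₂⟩
  exact absurd (h.inj h') (show (2 : Fin 3) ≠ 0 by decide)

theorem hasPath_path3 {f : path3.V → V} {p : V} (h : Hangs path3 G f p) :
    HasPath G 2 p (f path3.root) := by
  have h₀ : path3.graph.Adj (0 : Fin 3) (1 : Fin 3) := by rw [path3_adj]; decide
  have h₂ : path3.graph.Adj (1 : Fin 3) (2 : Fin 3) := by rw [path3_adj]; decide
  refine ⟨f (1 : Fin 3), h.ne _ (show (1 : Fin 3) ≠ 0 by decide), (h.adj _ _).2 h₀,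
    f (2 : Fin 3), fun h' => ?_, (h.adj _ _).2 h₂, trivial⟩
  exact absurd (h.inj h') (show (2 : Fin 3) ≠ 0 by decide)

/-- Types depend only on what hangs below the vertex, so the same statement serves the whole tree,
with `p` its root, and the padded tree, with `p` the new root. -/
theorem hasType_liftPair (k i : ℕ) :
    (∀ {f : (liftPair k i).1.V → V} {p : V}, Hangs (liftPair k i).1 G f p →
      HasType G i p (f (liftPair k i).1.root)) ∧
    ∀ {f : (liftPair k i).2.V → V} {p : V}, Hangs (liftPair k i).2 G f p →
      ¬ HasType G i p (f (liftPair k i).2.root) := by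
  induction i with
  | zero =>
    exact ⟨fun h => h.not_hasBranching_path3, fun h => not_not.2 h.hasBranching_cherry⟩
  | succ i ih =>
    refine ⟨fun {f p} h => ?_, fun {f p} h => ?_⟩
    · exact ⟨f (RootedGraph.last k _ _ (liftPair k i).2.root), h.ne _ last_ne_root, h.adj_last,
        ih.2 h.last⟩
    · rintro ⟨w, hwp, hw, hw'⟩
      obtain ⟨j, rfl⟩ | rfl := h.adj_cases hw hwp
      · exact hw' (ih.1 (h.copy j))
      · exact hw' (ih.1 h.last)

theorem hasPath_liftPair {k : ℕ} (hk : 0 < k) (i : ℕ) {f : (liftPair k i).1.V → V} {p : V}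
    (h : Hangs (liftPair k i).1 G f p) : HasPath G (i + 2) p (f (liftPair k i).1.root) := by
  induction i generalizing p with
  | zero => exact h.hasPath_path3
  | succ i ih =>
    exact ⟨f (RootedGraph.copy k _ _ ⟨0, hk⟩ (liftPair k i).1.root), h.ne _ copy_ne_root,
      h.adj_copy _, ih (h.copy _)⟩

theorem isCentral_liftPair {k : ℕ} (hk : 2 ≤ k) (i : ℕ) {f : (liftPair k (i + 1)).1.V → V} {p : V}
    (h : Hangs (liftPair k (i + 1)).1 G f p) :
    IsCentral G (i + 2) (f (liftPair k (i + 1)).1.root) := by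
  refine ⟨f (RootedGraph.copy k _ _ ⟨0, by omega⟩ (liftPair k i).1.root),
    f (RootedGraph.copy k _ _ ⟨1, by omega⟩ (liftPair k i).1.root), fun h' => ?_,
    h.adj_copy _, h.adj_copy _, (h.copy _).hasPath_liftPair (by omega) i,
    (h.copy _).hasPath_liftPair (by omega) i⟩
  exact absurd (congrArg Fin.val (copy_inj.1 (h.inj h')).1) Nat.zero_ne_one

end Hangs

/-! ### Distinguishing sentences -/

/-- In the second tree the root is the only vertex of rank above `i + 2`, so the central vertex
claimed by the sentence must be the root, which has the wrong type. -/
theorem distinguishes_rootSentence {l k : ℕ} (hk : 2 ≤ k) {u v w : Fin l} (huv : u ≠ v)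
    (huw : u ≠ w) (hvw : v ≠ w) (i : ℕ) : (Formula.rootSentence u v w i).Distinguishes
      (liftPair k (i + 1)).1.graph (liftPair k (i + 1)).2.graph := by
  refine ⟨Formula.freeVars_rootSentence u v w i, fun a => ?_, fun h => ?_⟩
  · rw [Formula.sat_rootSentence huv huw hvw]
    exact ⟨_, (hangs_self _).isCentral_liftPair hk i,
      (Hangs.hasType_liftPair k (i + 1)).1 (hangs_self _)⟩
  · obtain ⟨r, hr, hr'⟩ := (Formula.sat_rootSentence huv huw hvw _ i _).1
      (h fun _ => (liftPair k (i + 1)).2.root)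
    obtain ⟨ρ, hρ, hroot⟩ := (exists_isRank_liftPair k (i + 1)).2
    have hlt := hρ.lt_of_isCentral hr
    obtain rfl : r = (liftPair k (i + 1)).2.root := by
      by_contra hne
      have := hρ.lt_root r hne
      omega
    exact (Hangs.hasType_liftPair k (i + 1)).2 (hangs_self _) hr'

/-- The graph with one vertex. -/
def single : RootedGraph := ⟨Unit, ⊥, ()⟩

theorem isRank_single : IsRank single fun _ => 0 where
  lt_root _ h := (h rfl).elim
  up _ h := (h rfl).elim
  unique _ _ _ _ _ _ _ := rfl

theorem hangs_last (m : ℕ) (B C : RootedGraph) :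
    Hangs C (B.lift m C).graph (last m B C) (B.lift m C).root := (hangs_self (B.lift m C)).last

theorem not_hasPath_single {m j : ℕ} {C : RootedGraph} (l : Fin m) (v : single.V) :
    ¬ HasPath (single.lift m C).graph (j + 1) (single.lift m C).root (copy m single C l v) := by
  rintro ⟨w, hw, hadj, -⟩
  revert hw hadj
  refine lift_cases (P := fun w => w ≠ (single.lift m C).root → (single.lift m C).graph.Adj _ w →
    False) (by simp) (fun l' v' => ?_) (fun v => ?_) w
  · rintro - ⟨-, h⟩
    exact h
  · rintro - h
    exact not_adj_copy_last h

theorem not_hasPath_root {m j : ℕ} {C : RootedGraph} :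
    ¬ HasPath (single.lift m C).graph (j + 2) (last m single C C.root) (single.lift m C).root := by
  rintro ⟨w, hw, hadj, hp⟩
  obtain ⟨l, rfl⟩ | rfl := (hangs_self _).adj_cases hadj hadj.ne'
  · exact not_hasPath_single l _ hp
  · exact hw rfl

/-- The new root is recognised among the neighbours of the central vertex as the one from which no
walk of length 2 leads away. Only distinguishability is at stake, so the alternations of this
sentence do not matter. -/
theorem distinguishes_paddedSentence {l k : ℕ} (hk : 2 ≤ k) {u v w : Fin l} (huv : u ≠ v)
    (huw : u ≠ w) (hvw : v ≠ w) (m i : ℕ) : (Formula.paddedSentence u v w i).Distinguishes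
      (single.lift m (liftPair k (i + 1)).1).graph
      (single.lift m (liftPair k (i + 1)).2).graph := by
  refine ⟨Formula.freeVars_paddedSentence u v w i, fun a => ?_, fun h => ?_⟩
  · rw [Formula.sat_paddedSentence huv huw hvw]
    have hang := hangs_last m single (liftPair k (i + 1)).1
    exact ⟨_, hang.isCentral_liftPair hk i, _, adj_last_root.2 rfl, not_hasPath_root,
      (Hangs.hasType_liftPair k (i + 1)).1 hang⟩
  · obtain ⟨r, hr, p, hrp, hp, hr'⟩ := (Formula.sat_paddedSentence huv huw hvw _ i _).1
      (h fun _ => (single.lift m (liftPair k (i + 1)).2).root)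
    have hang := hangs_last m single (liftPair k (i + 1)).2
    obtain ⟨ρ, hρ, hroot⟩ := (exists_isRank_liftPair k (i + 1)).2
    have hlt := (isRank_single.lift hρ m (h := i + 4) (by omega) (by omega)).lt_of_isCentral hr
    -- Only the new root, of rank `i + 4`, and the old root, of rank `i + 3`, have rank above `i +
    -- 2`. The new root is not central: its other neighbours are leaves.
    obtain rfl : r = last m single _ (liftPair k (i + 1)).2.root := by
      revert hr hlt
      refine lift_cases (P := fun r => IsCentral _ (i + 2) r → i + 2 < liftRank m (i + 4) _ ρ r →
        r = _) ?_ (fun l v => ?_) (fun v => ?_) r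
      · rintro ⟨x, y, hxy, hx, hy, hpx, hpy⟩ -
        have key (x) (hx : (single.lift m (liftPair k (i + 1)).2).graph.Adj
            (single.lift m (liftPair k (i + 1)).2).root x)
            (hpx : HasPath (single.lift m (liftPair k (i + 1)).2).graph (i + 2)
              (single.lift m (liftPair k (i + 1)).2).root x) :
            x = last m single _ (liftPair k (i + 1)).2.root := by
          obtain ⟨l, rfl⟩ | rfl := (hangs_self _).adj_cases hx hx.ne'
          · exact (not_hasPath_single l _ hpx).elim
          · rfl
        exact (hxy ((key x hx hpx).trans (key y hy hpy).symm)).elim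
      · intro _ hlt
        simp at hlt
      · intro _ hlt
        rw [liftRank_last] at hlt
        by_cases hv : v = (liftPair k (i + 1)).2.root
        · rw [hv]
        · have := hρ.lt_root v hv
          omega
    by_cases hne : p = (single.lift m (liftPair k (i + 1)).2).root
    · subst hne
      exact (Hangs.hasType_liftPair k (i + 1)).2 hang hr'
    -- All other neighbours of the old root are roots of branches, below which there are walks of
    -- length `i + 2`.
    · obtain ⟨j, rfl⟩ | rfl := Hangs.adj_cases hang hrp hne
      · exact hp (((hang.copy j).hasPath_liftPair (by omega) i).mono (by omega))
      · exact hp ((hang.last.hasPath_liftPair (by omega) i).mono (by omega))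

/-! ### Bounds for the alternation depth -/

/-- The number of vertices of the trees of `liftPair k i`. -/
def liftCard (k : ℕ) : ℕ → ℕ
  | 0 => 3
  | i + 1 => (k + 1) * liftCard k i + 1

theorem finite_lift {m : ℕ} {B C : RootedGraph} [Finite B.V] [Finite C.V] :
    Finite (B.lift m C).V :=
  inferInstanceAs (Finite (Option ((Fin m × B.V) ⊕ C.V)))

theorem card_lift {m : ℕ} {B C : RootedGraph} [Finite B.V] [Finite C.V] :
    Nat.card (B.lift m C).V = m * Nat.card B.V + Nat.card C.V + 1 := by
  change Nat.card (Option ((Fin m × B.V) ⊕ C.V)) = _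
  rw [Finite.card_option, Nat.card_sum, Nat.card_prod, Nat.card_fin]

theorem card_liftPair (k i : ℕ) :
    (Finite (liftPair k i).1.V ∧ Nat.card (liftPair k i).1.V = liftCard k i) ∧
      Finite (liftPair k i).2.V ∧ Nat.card (liftPair k i).2.V = liftCard k i := by
  induction i with
  | zero =>
    exact ⟨⟨inferInstanceAs (Finite (Fin 3)), Nat.card_fin 3⟩,
      ⟨inferInstanceAs (Finite (Fin 3)), Nat.card_fin 3⟩⟩
  | succ i ih =>
    obtain ⟨⟨h₁, h₂⟩, h₃, h₄⟩ := ih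
    refine ⟨⟨finite_lift, ?_⟩, finite_lift, ?_⟩
    · exact card_lift.trans (by rw [h₂, h₄, liftCard]; ring)
    · exact card_lift.trans (by rw [h₂, liftCard]; ring)

/-- The recursion has the closed form `h`. The bound reduces to 3k + 1 < k(k + 1), which holds from
k = 3 on. -/
theorem liftCard_lt {k : ℕ} (hk : 3 ≤ k) (i : ℕ) : liftCard k i < (k + 1) ^ (i + 1) := by
  have h : k * liftCard k i + 1 = (3 * k + 1) * (k + 1) ^ i := by
    induction i with
    | zero => simp [liftCard]; ring
    | succ i ih => rw [pow_succ, ← mul_assoc, ← ih, liftCard]; ring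
  have h₁ : (3 * k + 1) * (k + 1) ^ i < k * (k + 1) ^ (i + 1) := by
    rw [pow_succ, mul_comm ((k + 1) ^ i), ← mul_assoc]
    exact Nat.mul_lt_mul_of_pos_right (by nlinarith) (by positivity)
  by_contra! hle
  have := Nat.mul_le_mul_left k hle
  omega

theorem le_treeAlt {k n i : ℕ} {X Y : RootedGraph} (hX : X.graph.IsTree) (hY : Y.graph.IsTree)
    (eX : X.V ≃ Fin n) (eY : Y.V ≃ Fin n) (hXY : Distinguishable k X.graph Y.graph)
    (h : ∀ m, Survives k m i Y X ∅) : i ≤ treeAlt k n := by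
  classical
  set G := X.graph.map eX.toEmbedding
  set H := Y.graph.map eY.toEmbedding
  have fX : X.graph ≃g G := SimpleGraph.Iso.map eX X.graph
  have fY : Y.graph ≃g H := SimpleGraph.Iso.map eY Y.graph
  have hGH : Distinguishable k G H :=
    hXY.imp fun φ => (Formula.distinguishes_iso fX fY φ).2
  have hle : altDist k G H ≤ treeAlt k n := by
    unfold treeAlt
    refine Finset.le_sup
      (f := fun P : SimpleGraph (Fin n) × SimpleGraph (Fin n) => altDist k P.1 P.2)
      (b := (G, H)) ?_
    simp only [Finset.mem_filter, Finset.mem_univ, true_and]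
    exact ⟨fX.isTree_iff.1 hX, fY.isTree_iff.1 hY, hGH⟩
  refine le_trans ?_ hle
  obtain ⟨φ, hφ⟩ := hGH
  obtain ⟨ψ, hψ, hd⟩ := Nat.sInf_mem
    (s := {d | ∃ φ : Formula k, φ.Distinguishes G H ∧ φ.altDepth = d}) ⟨_, φ, hφ, rfl⟩
  change _ = altDist k G H at hd
  by_contra! hlt
  obtain ⟨i, rfl⟩ : ∃ i', i = i' + 1 := ⟨i - 1, by omega⟩
  exact not_distinguishes_of_survives h ψ (Formula.BlocksLE.of_altDepth (by omega))
    ((Formula.distinguishes_iso fX fY ψ).1 hψ)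

theorem le_treeAlt_of_liftCard_lt {k n i : ℕ} (hk : 3 ≤ k) (hn : liftCard k (i + 1) < n) :
    i + 1 ≤ treeAlt k n := by
  -- The new root takes one vertex, which the strict inequality provides; the remaining `m` become
  -- leaves.
  obtain ⟨m, rfl⟩ : ∃ m, n = m + liftCard k (i + 1) + 1 := ⟨n - liftCard k (i + 1) - 1, by omega⟩
  obtain ⟨⟨h₁, h₂⟩, h₃, h₄⟩ := card_liftPair k (i + 1)
  obtain ⟨⟨ρ, hρ, hρ'⟩, ⟨τ, hτ, hτ'⟩⟩ := exists_isRank_liftPair k (i + 1)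
  have : Finite single.V := inferInstanceAs (Finite Unit)
  have hcard : Nat.card single.V = 1 := Nat.card_unique (α := Unit)
  have key {B : RootedGraph} (h : Finite B.V) (hB : Nat.card B.V = liftCard k (i + 1)) :
      Nonempty ((single.lift m B).V ≃ Fin (m + liftCard k (i + 1) + 1)) := by
    have := finite_lift (m := m) (B := single) (C := B)
    refine ⟨Finite.equivFinOfCardEq ?_⟩
    rw [card_lift, hcard, hB, mul_one]
  obtain ⟨eX⟩ := key h₁ h₂
  obtain ⟨eY⟩ := key h₃ h₄
  refine le_treeAlt (isRank_single.lift hρ m (h := i + 4) (by omega) (by omega)).isTree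
    (isRank_single.lift hτ m (h := i + 4) (by omega) (by omega)).isTree eX eY
    ⟨_, distinguishes_paddedSentence (u := ⟨0, by omega⟩) (v := ⟨1, by omega⟩)
      (w := ⟨2, by omega⟩) (by omega) (by simp) (by simp) (by simp) m i⟩
    fun n => survives_lift m single (survives_liftPair k n (i + 1))

theorem logb_lt_treeAlt {k : ℕ} (hk : 3 ≤ k) {n : ℕ} (hn : 1 ≤ n) :
    Real.logb ((k : ℝ) + 1) n - 2 < treeAlt k n := by
  have key {i : ℕ} (hi : n ≤ liftCard k (i + 1)) : Real.logb ((k : ℝ) + 1) n - 2 < i := by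
    have h₁ : (n : ℝ) < ((k : ℝ) + 1) ^ (i + 2) := by
      exact_mod_cast hi.trans_lt (liftCard_lt hk (i + 1))
    have h₂ : (1 : ℝ) < (k : ℝ) + 1 := by
      have : 0 < k := by omega
      simpa using this
    have h₃ := Real.logb_lt_logb h₂ (by exact_mod_cast hn) h₁
    rw [Real.logb_pow, Real.logb_self_eq_one h₂] at h₃
    push_cast at h₃
    linarith
  have hmono (i : ℕ) : i ≤ liftCard k i := by
    induction i with
    | zero => exact Nat.zero_le _
    | succ i ih => rw [liftCard]; nlinarith
  have hex : ∃ i, n ≤ liftCard k (i + 1) := ⟨n, (Nat.le_succ n).trans (hmono (n + 1))⟩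
  classical
  -- For the least `i` with `n ≤ liftCard k (i + 1)`, the size gives the logarithmic bound, and
  -- minimality makes the trees of level `i` fit into `n` vertices unless `i = 0`.
  refine (key (Nat.find_spec hex)).trans_le ?_
  rcases hi : Nat.find hex with _ | i
  · simp
  · have := Nat.find_min hex (m := i) (by omega)
    exact_mod_cast le_treeAlt_of_liftCard_lt hk (not_le.1 this)

end FOAlt

theorem theorem2 (k : ℕ) (hk : 3 ≤ k) :
    (∀ n : ℕ, 1 ≤ n →
      Real.logb ((k : ℝ) + 1) (n : ℝ) - 2 < (FOAlt.treeAlt k n : ℝ)) ∧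
    (∀ i : ℕ, 1 ≤ i →
      FOAlt.distDepth 3 (FOAlt.Formula.IsSigma i)
          (FOAlt.treePair k i).1.graph (FOAlt.treePair k i).2.graph ≤ ((i + 5 : ℕ) : ℕ∞) ∧
      FOAlt.distDepth k (FOAlt.Formula.IsPi i)
          (FOAlt.treePair k i).1.graph (FOAlt.treePair k i).2.graph = ⊤) := by
  refine ⟨fun n => FOAlt.logb_lt_treeAlt hk, fun i hi => ?_⟩
  obtain ⟨i, rfl⟩ : ∃ i', i = i' + 1 := ⟨i - 1, by omega⟩
  rw [FOAlt.treePair_succ]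
  constructor
  · refine (iInf_le _ ⟨FOAlt.Formula.rootSentence 0 1 2 i,
      FOAlt.Formula.isSigma_rootSentence 0 1 2 i,
      FOAlt.distinguishes_rootSentence (by omega) (by decide) (by decide) (by decide) i⟩).trans ?_
    rw [FOAlt.Formula.depth_rootSentence]
  · rw [FOAlt.distDepth, iInf_eq_top]
    rintro ⟨φ, hφ, hd⟩
    exact absurd hd (FOAlt.not_distinguishes_of_survives
      (fun m => FOAlt.survives_liftPair k m (i + 1)) φ (FOAlt.Formula.BlocksLE.of_isPi hφ))
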